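/- **Definitions.** For a finite group $G$, let $\pi(G)$ be the set of primes dividing $|G|$. The prime graph of $G$ is the graph with vertex set $\pi(G)$ in which distinct vertices $r,s$ are joined by an edge if and only if $G$ has an element of order $rs$; its complement (on the same vertex set $\pi(G)$) is denoted $\overline{\Gamma}(G)$. These graphs are labelled by primes, and an equality between them means equality of vertex sets and of edge sets. For a simple group $T$, a group $G$ is *strictly $T$-solvable* if every composition factor of $G$ is cyclic or isomorphic to $T$, and at least one composition factor of $G$ is isomorphic to $T$. Let $p$ be a prime, let $\mathbb{F}=\overline{\mathbb{F}}_p$ be an algebraic closure of the field with $p$ elements, and fix an injective homomorphism $\lambda\colon\mathbb{F}^\times\to\mathbb{C}^\times$. The Brauer character mod $p$ of a representation $\varphi\colon T\to\mathrm{GL}_n(\mathbb{F})$ of a finite group $T$ is the complex-valued function on the set of elements $g\in T$ of order not divisible by $p$ given by $g\mapsto\sum_{i=1}^n\lambda(\varepsilon_i)$, where $\varepsilon_1,\dots,\varepsilon_n$ are the eigenvalues of $\varphi(g)$ with multiplicity. It is called irreducible if $\varphi$ is irreducible. **Theorem.** Let $T$ be a finite simple group, let $p\in\pi(T)$, and let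 $\chi$ be an irreducible Brauer character of $T$ mod $p$. Let $R\subseteq\pi(T)\setminus\{p\}$ be the set of primes $r\neq p$ for which there exists an element $t\in T$ of order $r$ such that $$\frac{1}{o(t)}\sum_{x\in\langle t\rangle}\chi(x)>0 ,$$ where $o(t)$ denotes the order of $t$. Then there exists a finite strictly $T$-solvable group $G$ such that $$\overline{\Gamma}(G)=\overline{\Gamma}(T)\setminus\{\,p-r \mid r\in R\,\},$$ that is, $\overline{\Gamma}(G)$ is the graph obtained from $\overline{\Gamma}(T)$ by deleting all edges joining $p$ to a prime in $R$, keeping all vertices. -/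

import Mathlib

universe u v w

/-! ### Prime graphs

A labelled graph whose vertices are natural numbers is a subgraph of the complete graph on `ℕ`;
it carries its own vertex set, so that equality of labelled graphs means equality of the vertex
sets and of the edge sets. -/

/-- Graphs whose vertices are labelled by natural numbers. -/
abbrev LabelledGraph : Type := (⊤ : SimpleGraph ℕ).Subgraph

/-- The set `π(G)` of primes that divide the order of `G`. -/
def primeDivisors (G : Type u) : Set ℕ := {r | r.Prime ∧ r ∣ Nat.card G}

/-- The prime graph (Gruenberg-Kegel graph) of `G`: the vertices are the prime divisors of the
order of `G`, and distinct vertices `r`, `s` are joined when `G` has an element of order `r * s`. -/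
def primeGraph (G : Type u) [Group G] : LabelledGraph where
  verts := primeDivisors G
  Adj r s := r ∈ primeDivisors G ∧ s ∈ primeDivisors G ∧ r ≠ s ∧ ∃ g : G, orderOf g = r * s
  adj_sub h := h.2.2.1
  edge_vert h := h.1
  symm := ⟨fun _ _ ⟨hr, hs, hne, g, hg⟩ =>
    ⟨hs, hr, hne.symm, g, hg.trans (Nat.mul_comm _ _)⟩⟩

/-- The complement of a labelled graph, on the same vertex set. -/
def LabelledGraph.complement (Γ : LabelledGraph) : LabelledGraph where
  verts := Γ.verts
  Adj r s := r ∈ Γ.verts ∧ s ∈ Γ.verts ∧ r ≠ s ∧ ¬ Γ.Adj r s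
  adj_sub h := h.2.2.1
  edge_vert h := h.1
  symm := ⟨fun _ _ ⟨hr, hs, hne, h⟩ => ⟨hs, hr, hne.symm, fun h2 => h h2.symm⟩⟩

/-- The complement of the prime graph of `G`. -/
def primeGraphCompl (G : Type u) [Group G] : LabelledGraph :=
  LabelledGraph.complement (primeGraph G)

/-! ### Composition series and `T`-solvable groups -/

/-- A composition series `1 = H₀ ⊲ H₁ ⊲ ⋯ ⊲ Hₙ = G`: each term is normal in the next one, with
simple quotient. -/
structure GroupCompositionSeries (G : Type u) [Group G] where
  length : ℕ
  term : Fin (length + 1) → Subgroup G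
  term_zero : term 0 = ⊥
  term_last : term (Fin.last length) = ⊤
  le_succ : ∀ i : Fin length, term i.castSucc ≤ term i.succ
  normal : ∀ i : Fin length, ((term i.castSucc).subgroupOf (term i.succ)).Normal
  simple : ∀ i : Fin length,
    IsSimpleGroup (term i.succ ⧸ (term i.castSucc).subgroupOf (term i.succ))

/-- The `i`-th factor `Hᵢ₊₁ / Hᵢ` of a composition series. -/
abbrev GroupCompositionSeries.factor {G : Type u} [Group G] (c : GroupCompositionSeries G)
    (i : Fin c.length) : Type u :=
  c.term i.succ ⧸ (c.term i.castSucc).subgroupOf (c.term i.succ)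

instance GroupCompositionSeries.factorGroup {G : Type u} [Group G] (c : GroupCompositionSeries G)
    (i : Fin c.length) : Group (c.factor i) :=
  haveI := c.normal i
  QuotientGroup.Quotient.group _

/-- `S` is a composition factor of `G`. -/
def IsCompositionFactor (S : Type v) [Group S] (G : Type u) [Group G] : Prop :=
  ∃ (c : GroupCompositionSeries G) (i : Fin c.length), Nonempty (c.factor i ≃* S)

/-- `G` is `T`-solvable: every composition factor of `G` is cyclic or isomorphic to `T`. -/
def IsSolvableRel (T : Type v) [Group T] (G : Type u) [Group G] : Prop :=
  ∀ (c : GroupCompositionSeries G) (i : Fin c.length),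
    IsCyclic (c.factor i) ∨ Nonempty (c.factor i ≃* T)

/-- `G` is strictly `T`-solvable: it is `T`-solvable and `T` is one of its composition factors. -/
def IsStrictlySolvableRel (T : Type v) [Group T] (G : Type u) [Group G] : Prop :=
  IsSolvableRel T G ∧ IsCompositionFactor T G

/-! ### Brauer characters -/

/-- The `p`-regular elements of `T`: those of order not divisible by `p`. -/
abbrev PRegular (p : ℕ) (T : Type u) [Group T] : Type u := {g : T // ¬ p ∣ orderOf g}

/-- Every element of the cyclic group generated by a `p`-regular element is `p`-regular. -/
theorem PRegular.not_dvd_of_mem_zpowers {p : ℕ} {T : Type u} [Group T] (t : PRegular p T)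
    (x : Subgroup.zpowers t.1) : ¬ p ∣ orderOf x.1 :=
  fun h => t.2 (h.trans (orderOf_dvd_of_mem_zpowers x.2))

/-- The Brauer character of a representation `ρ` over the algebraic closure of `𝔽_p`: a `p`-regular
element `g` is sent to the sum of the lifts to `ℂ` of the eigenvalues of `ρ g`, counted with
multiplicity. An injective homomorphism `lift` of monoids with zero is the same thing as an
embedding of the multiplicative group of the field into that of `ℂ`, that is, an isomorphism of
that group with the group of complex roots of unity of order prime to `p`. -/
noncomputable def brauerCharacter {p : ℕ} [Fact p.Prime]
    (lift : AlgebraicClosure (ZMod p) →*₀ ℂ) {T : Type u} [Group T]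
    {V : Type w} [AddCommGroup V] [Module (AlgebraicClosure (ZMod p)) V]
    [FiniteDimensional (AlgebraicClosure (ZMod p)) V]
    (ρ : Representation (AlgebraicClosure (ZMod p)) T V) (g : PRegular p T) : ℂ :=
  ((ρ g.1).charpoly.roots.map lift).sum

/-- `χ` is an irreducible Brauer character of `T` mod `p` (with respect to `lift`). -/
def IsIrreducibleBrauerCharacter {p : ℕ} [Fact p.Prime]
    (lift : AlgebraicClosure (ZMod p) →*₀ ℂ) {T : Type u} [Group T] (χ : PRegular p T → ℂ) : Prop :=
  ∃ (n : ℕ) (ρ : Representation (AlgebraicClosure (ZMod p)) T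
      (Fin n → AlgebraicClosure (ZMod p))),
    ρ.IsIrreducible ∧ χ = brauerCharacter lift ρ

/-- The average of `χ` over the cyclic group generated by the `p`-regular element `t`. -/
noncomputable def cyclicAverage {p : ℕ} {T : Type u} [Group T] (χ : PRegular p T → ℂ)
    (t : PRegular p T) : ℂ :=
  1 / (orderOf t.1 : ℂ) *
    ∑ᶠ x : Subgroup.zpowers t.1, χ ⟨x.1, PRegular.not_dvd_of_mem_zpowers t x⟩

open scoped ComplexOrder in
/-- The set of primes `r` such that the average of `χ` over the cyclic group generated by some
(`p`-regular) element of order `r` is positive, i.e. a positive real number. -/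
def positiveAveragePrimes {p : ℕ} {T : Type u} [Group T] (χ : PRegular p T → ℂ) : Set ℕ :=
  {r | r.Prime ∧ ∃ t : PRegular p T, orderOf t.1 = r ∧ 0 < cyclicAverage χ t}

/-! ### Averages of Brauer characters -/

section Eigenvalues

open Polynomial

variable {K : Type*} [Field K] [IsAlgClosed K] {V : Type w} [AddCommGroup V] [Module K V]
  [FiniteDimensional K V]

/-! For a `p`-regular `t`, the average of the Brauer character over `⟨t⟩` is the multiplicity of the
eigenvalue 1 of `ρ t` (`cyclicAverage_brauerCharacter`). Hence `R` consists of the primes `r ≠ p`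
such that some element of order `r` fixes a nonzero vector of `V`.

Take `G = N ⋊ T`, where `N` is a finite `T`-invariant `𝔽_p`-subspace of `V` containing a nonzero
fixed vector of every `t` that has one. As `N` is elementary abelian and `p` divides `|T|`, no new
primes appear, and element orders prime to `p` are those of `T`. An element of order `p * s` exists
iff one exists in `T` or some element of order `s` centralises a nontrivial element of `N`
(`SemidirectProduct.exists_orderOf_eq_mul_iff`), which is the condition `s ∈ R`.

Since `G → T` is onto with abelian kernel, the composition factors of `G` are cyclic or `T`, and `T`
occurs. -/

theorem Module.End.card_roots_charpoly (A : Module.End K V) :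
    Multiset.card (A.charpoly.roots) = Module.finrank K V := by
  rw [← (IsAlgClosed.splits A.charpoly).natDegree_eq_card_roots, LinearMap.charpoly_natDegree]

/-- Both sides are multiplicative in `f`, and `f` splits, so constants and factors `X - C b`
suffice. For the latter, both sides are the characteristic polynomial at `b`, up to the sign `(-1) ^
dim V`. -/
theorem Module.End.det_aeval (A : Module.End K V) (f : K[X]) :
    LinearMap.det (aeval A f) = (A.charpoly.roots.map fun ε => f.eval ε).prod := by
  let φ₁ : K[X] →* K := LinearMap.det.comp (aeval A : K[X] →ₐ[K] Module.End K V).toMonoidHom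
  let φ₂ : K[X] →* K :=
    { toFun := fun f => (A.charpoly.roots.map fun ε => f.eval ε).prod
      map_one' := by simp
      map_mul' := fun f g => by simp [Multiset.prod_map_mul] }
  change φ₁ f = φ₂ f
  have hC : ∀ c : K, φ₁ (C c) = φ₂ (C c) := fun c => by
    have h1 : φ₁ (C c) = LinearMap.det (aeval A (C c)) := rfl
    have h2 : φ₂ (C c) = (A.charpoly.roots.map fun ε => (C c).eval ε).prod := rfl
    rw [h1, h2, aeval_C, Algebra.algebraMap_eq_smul_one, LinearMap.det_smul]
    simp [Module.End.card_roots_charpoly]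
  have hX : ∀ b : K, φ₁ (X - C b) = φ₂ (X - C b) := fun b => by
    have h1 : φ₁ (X - C b) = LinearMap.det (aeval A (X - C b)) := rfl
    have h2 : φ₂ (X - C b) = (A.charpoly.roots.map fun ε => (X - C b).eval ε).prod := rfl
    have h3 : aeval A (X - C b) = (-1 : K) • (algebraMap K (Module.End K V) b - A) := by
      simp
    have h4 : A.charpoly.eval b = (A.charpoly.roots.map fun ε => b - ε).prod := by
      conv_lhs => rw [(IsAlgClosed.splits A.charpoly).eq_prod_roots_of_monic A.charpoly_monic]
      rw [eval_multiset_prod, Multiset.map_map]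
      simp
    rw [h1, h2, h3, LinearMap.det_smul, ← LinearMap.eval_charpoly, h4,
      ← Module.End.card_roots_charpoly A, ← Multiset.card_map (fun ε => b - ε),
      ← Multiset.prod_map_neg]
    simp
  rw [(IsAlgClosed.splits f).eq_prod_roots, map_mul, map_mul, hC, map_multiset_prod,
    map_multiset_prod, Multiset.map_map, Multiset.map_map]
  congr 2
  exact Multiset.map_congr rfl fun b _ => hX b

theorem Module.End.roots_charpoly_pow (A : Module.End K V) (k : ℕ) :
    (A ^ k).charpoly.roots = A.charpoly.roots.map (· ^ k) := by
  have h : (A ^ k).charpoly = ((A.charpoly.roots.map (· ^ k)).map fun a => X - C a).prod := by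
    refine Polynomial.funext fun x => ?_
    -- At each point `x`, the value is the determinant of `C x - X ^ k` evaluated at `A`.
    have h1 : algebraMap K (Module.End K V) x - A ^ k = aeval A (C x - X ^ k) := by simp
    rw [LinearMap.eval_charpoly, h1, Module.End.det_aeval, eval_multiset_prod, Multiset.map_map,
      Multiset.map_map]
    simp
  rw [h, roots_multiset_prod_X_sub_C]

theorem Module.End.pow_eq_one_of_mem_roots_charpoly {A : Module.End K V} {k : ℕ} (hA : A ^ k = 1)
    {ε : K} (hε : ε ∈ A.charpoly.roots) : ε ^ k = 1 := by
  have h : ε ^ k ∈ (A ^ k).charpoly.roots := by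
    rw [Module.End.roots_charpoly_pow]
    exact Multiset.mem_map_of_mem _ hε
  rw [hA, LinearMap.charpoly_one] at h
  have h2 := (mem_roots'.1 h).2
  rw [IsRoot, eval_pow, eval_sub, eval_X, eval_one] at h2
  exact sub_eq_zero.1 (eq_zero_of_pow_eq_zero h2)

end Eigenvalues

/-- Orthogonality for roots of unity; injectivity of `lift` keeps `ε ≠ 1` away from 1 in `ℂ`. -/
theorem geom_sum_lift_eq_ite {K : Type*} [Field K] [DecidableEq K] (lift : K →*₀ ℂ)
    (hlift : Function.Injective lift) {ε : K} {m : ℕ} (hε : ε ^ m = 1) :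
    ∑ i ∈ Finset.range m, lift ε ^ i = if ε = 1 then (m : ℂ) else 0 := by
  split_ifs with h
  · simp [h]
  · have h1 : lift ε ≠ 1 := fun h2 => h (hlift (h2.trans (map_one lift).symm))
    rw [geom_sum_eq h1, ← map_pow, hε, map_one, sub_self, zero_div]

open Classical in
theorem sum_geom_multiset_lift {K : Type*} [Field K] (lift : K →*₀ ℂ)
    (hlift : Function.Injective lift) {s : Multiset K} {m : ℕ} (hs : ∀ ε ∈ s, ε ^ m = 1) :
    ∑ i ∈ Finset.range m, (s.map fun ε => lift ε ^ i).sum = m * (s.count 1 : ℂ) := by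
  induction s using Multiset.induction_on with
  | empty => simp
  | cons a s ih =>
    simp only [Multiset.map_cons, Multiset.sum_cons]
    rw [Finset.sum_add_distrib, ih fun ε hε => hs ε (Multiset.mem_cons_of_mem hε),
      geom_sum_lift_eq_ite lift hlift (hs a (Multiset.mem_cons_self a s)), Multiset.count_cons]
    simp only [eq_comm (a := (1 : K))]
    split_ifs <;> push_cast <;> ring

section BrauerAverage

variable {p : ℕ} [Fact p.Prime] (lift : AlgebraicClosure (ZMod p) →*₀ ℂ)
  {T : Type u} [Group T] [Finite T] {V : Type w} [AddCommGroup V]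
  [Module (AlgebraicClosure (ZMod p)) V] [FiniteDimensional (AlgebraicClosure (ZMod p)) V]
  (ρ : Representation (AlgebraicClosure (ZMod p)) T V)

open Classical in
/-- The average of a Brauer character over a cyclic group is the multiplicity of the
eigenvalue `1` of a generator. -/
theorem cyclicAverage_brauerCharacter (hlift : Function.Injective lift) (t : PRegular p T) :
    cyclicAverage (brauerCharacter lift ρ) t = ((ρ t.1).charpoly.roots.count 1 : ℂ) := by
  have hpos : orderOf t.1 ≠ 0 := (orderOf_pos t.1).ne'
  have hpow : ρ t.1 ^ orderOf t.1 = 1 := by rw [← map_pow, pow_orderOf_eq_one, map_one]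
  have hsum : ∑ᶠ x : Subgroup.zpowers t.1, brauerCharacter lift ρ
        ⟨x.1, PRegular.not_dvd_of_mem_zpowers t x⟩ =
      ∑ i ∈ Finset.range (orderOf t.1), ((ρ t.1).charpoly.roots.map fun ε => lift ε ^ i).sum := by
    rw [← finsum_comp_equiv (finEquivZPowers (isOfFinOrder_of_finite t.1)),
      finsum_eq_sum_of_fintype, Finset.sum_range]
    refine Finset.sum_congr rfl fun i _ => ?_
    simp only [brauerCharacter, finEquivZPowers_apply, map_pow, Module.End.roots_charpoly_pow,
      Multiset.map_map, Function.comp_def]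
  rw [cyclicAverage, hsum, sum_geom_multiset_lift lift hlift fun ε hε =>
    Module.End.pow_eq_one_of_mem_roots_charpoly hpow hε]
  field_simp

open scoped ComplexOrder in
theorem brauerCharacter_average_pos_iff (hlift : Function.Injective lift) (t : PRegular p T) :
    0 < cyclicAverage (brauerCharacter lift ρ) t ↔ ∃ v : V, v ≠ 0 ∧ ρ t.1 v = v := by
  classical
  rw [cyclicAverage_brauerCharacter lift ρ hlift, Nat.cast_pos, Multiset.count_pos,
    Polynomial.mem_roots (ρ t.1).charpoly_monic.ne_zero,
    ← Module.End.hasEigenvalue_iff_isRoot_charpoly]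
  constructor
  · intro h
    obtain ⟨v, hv⟩ := h.exists_hasEigenvector
    exact ⟨v, hv.2, by simpa using hv.apply_eq_smul⟩
  · rintro ⟨v, hv, h⟩
    exact Module.End.hasEigenvalue_of_hasEigenvector (x := v)
      ⟨Module.End.mem_eigenspace_iff.2 (by simpa using h), hv⟩

end BrauerAverage

/-! ### Orders of elements of semidirect products -/

section SemidirectOrders

variable {N : Type v} [CommGroup N] {T : Type u} [Group T] {φ : T →* MulAut N} {p : ℕ}

theorem SemidirectProduct.orderOf_right_dvd (g : N ⋊[φ] T) : orderOf g.right ∣ orderOf g :=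
  orderOf_map_dvd (SemidirectProduct.rightHom : N ⋊[φ] T →* T) g

theorem SemidirectProduct.pow_orderOf_right (g : N ⋊[φ] T) :
    ∃ n : N, g ^ orderOf g.right = SemidirectProduct.inl n := by
  have h : g ^ orderOf g.right ∈ (SemidirectProduct.rightHom : N ⋊[φ] T →* T).ker := by
    rw [MonoidHom.mem_ker, map_pow]
    exact pow_orderOf_eq_one g.right
  rw [← SemidirectProduct.range_inl_eq_ker_rightHom] at h
  obtain ⟨n, hn⟩ := h
  exact ⟨n, hn.symm⟩

theorem SemidirectProduct.orderOf_dvd_mul (hN : ∀ n : N, n ^ p = 1) (g : N ⋊[φ] T) :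
    orderOf g ∣ orderOf g.right * p := by
  obtain ⟨n, hn⟩ := SemidirectProduct.pow_orderOf_right g
  exact orderOf_dvd_of_pow_eq_one (by rw [pow_mul, hn, ← map_pow, hN, map_one])

theorem SemidirectProduct.exists_orderOf_eq_iff_of_coprime (hN : ∀ n : N, n ^ p = 1) {m : ℕ}
    (hm : m.Coprime p) : (∃ g : N ⋊[φ] T, orderOf g = m) ↔ ∃ t : T, orderOf t = m := by
  constructor
  · rintro ⟨g, rfl⟩
    exact ⟨g.right, Nat.dvd_antisymm (SemidirectProduct.orderOf_right_dvd g)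
      (hm.dvd_of_dvd_mul_right (SemidirectProduct.orderOf_dvd_mul hN g))⟩
  · rintro ⟨t, rfl⟩
    exact ⟨SemidirectProduct.inr t, orderOf_injective _ SemidirectProduct.inr_injective t⟩

/-- The image in `T` of an element `g` of order `p * s` has order `s` or `p * s`. If it is `s`, then
`g ^ s` is a nontrivial element of `N` commuting with `g`; as `N` is abelian, the image of `g` fixes
it. Conversely, commuting elements of orders `p` and `s` have a product of order `p * s`. -/
theorem SemidirectProduct.exists_orderOf_eq_mul_iff (hp : p.Prime) (hN : ∀ n : N, n ^ p = 1)
    {s : ℕ} (hs : s.Prime) (hps : p ≠ s) :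
    (∃ g : N ⋊[φ] T, orderOf g = p * s) ↔
      (∃ t : T, orderOf t = p * s) ∨ ∃ t : T, orderOf t = s ∧ ∃ n : N, n ≠ 1 ∧ φ t n = n := by
  constructor
  · rintro ⟨g, hg⟩
    have h1 := SemidirectProduct.orderOf_right_dvd g
    have h2 := SemidirectProduct.orderOf_dvd_mul hN g
    rw [hg] at h1 h2
    rw [mul_comm] at h2
    obtain ⟨d, hd⟩ := Nat.dvd_of_mul_dvd_mul_right hp.pos h2
    rw [hd, mul_comm p s] at h1
    rcases (Nat.dvd_prime hp).1 (Nat.dvd_of_mul_dvd_mul_left hs.pos h1) with rfl | rfl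
    · rw [mul_one] at hd
      obtain ⟨n, hn⟩ := SemidirectProduct.pow_orderOf_right g
      refine Or.inr ⟨g.right, hd, n, ?_, ?_⟩
      · rintro rfl
        rw [map_one, hd] at hn
        have h3 := Nat.le_of_dvd hs.pos (orderOf_dvd_of_pow_eq_one hn)
        rw [hg] at h3
        nlinarith [hp.two_le, hs.pos]
      · have h3 : g * SemidirectProduct.inl n = SemidirectProduct.inl n * g := by
          rw [← hn, ← pow_succ, ← pow_succ']
        have h4 := congrArg SemidirectProduct.left h3
        simp only [SemidirectProduct.mul_left, SemidirectProduct.left_inl,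
          SemidirectProduct.right_inl, map_one, MulAut.one_apply] at h4
        rw [mul_comm n] at h4
        exact mul_left_cancel h4
    · exact Or.inl ⟨g.right, by rw [hd, mul_comm]⟩
  · rintro (⟨t, ht⟩ | ⟨t, ht, n, hn, hfix⟩)
    · exact ⟨SemidirectProduct.inr t, by
        rw [orderOf_injective _ SemidirectProduct.inr_injective t, ht]⟩
    · have := Fact.mk hp
      have hop : orderOf (SemidirectProduct.inl n : N ⋊[φ] T) = p := by
        rw [orderOf_injective _ SemidirectProduct.inl_injective n]
        exact orderOf_eq_prime (hN n) hn
      have hos : orderOf (SemidirectProduct.inr t : N ⋊[φ] T) = s := by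
        rw [orderOf_injective _ SemidirectProduct.inr_injective t, ht]
      have hcomm : Commute (SemidirectProduct.inl n : N ⋊[φ] T) (SemidirectProduct.inr t) := by
        ext <;> simp [hfix]
      refine ⟨SemidirectProduct.inl n * SemidirectProduct.inr t, ?_⟩
      rw [hcomm.orderOf_mul_eq_mul_orderOf_of_coprime, hop, hos]
      rw [hop, hos]
      exact (Nat.coprime_primes hp hs).2 hps

end SemidirectOrders

/-! ### Composition factors of extensions of a simple group by a commutative group -/

section CompositionFactors

open Subgroup

theorem isCyclic_of_isSimpleGroup_of_commute {Q : Type*} [Group Q] [IsSimpleGroup Q]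
    (h : ∀ a b : Q, a * b = b * a) : IsCyclic Q := by
  let _ : CommGroup Q := { ‹Group Q› with mul_comm := h }
  exact IsSimpleGroup.isCyclic

/-- A simple quotient of a group `A` with a homomorphism to a simple group `T`. -/
theorem isCyclic_or_nonempty_mulEquiv_of_surjective {A Q T : Type*} [Group A] [Group Q] [Group T]
    [IsSimpleGroup Q] [IsSimpleGroup T] (q : A →* Q) (hq : Function.Surjective q) (f : A →* T)
    (hcomm : ∀ a ∈ f.ker, ∀ b ∈ f.ker, a * b = b * a)
    (hA : f.range = ⊥ ∨ f.range = ⊤) (hB : q.ker.map f = ⊥ ∨ q.ker.map f = ⊤) :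
    IsCyclic Q ∨ Nonempty (Q ≃* T) := by
  have hn : (f.ker.map q).Normal := Subgroup.Normal.map inferInstance q hq
  -- The image of `f.ker` in `Q` is trivial or everything. In the first case `q.ker` contains
  -- `f.ker`, so `Q` is a nontrivial quotient of the image of `f`; in the second `Q` is abelian.
  rcases hn.eq_bot_or_eq_top with h | h
  · have hle : f.ker ≤ q.ker := (Subgroup.map_eq_bot_iff _).1 h
    have hne : q.ker ≠ ⊤ := fun h1 => by
      obtain ⟨x, hx⟩ := exists_ne (1 : Q)
      obtain ⟨a, rfl⟩ := hq x
      exact hx (MonoidHom.mem_ker.1 (h1 ▸ Subgroup.mem_top a))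
    rcases hA with hA | hA
    · exact absurd (top_le_iff.1 fun a _ => hle (by
        have h2 : f a ∈ f.range := ⟨a, rfl⟩
        rw [hA] at h2
        exact Subgroup.mem_bot.1 h2)) hne
    · rcases hB with hB | hB
      · have hle2 : q.ker ≤ f.ker := (Subgroup.map_eq_bot_iff _).1 hB
        exact Or.inr ⟨(QuotientGroup.quotientKerEquivOfSurjective q hq).symm.trans
          ((QuotientGroup.quotientMulEquivOfEq (le_antisymm hle2 hle)).trans
            (QuotientGroup.quotientKerEquivOfSurjective f (MonoidHom.range_eq_top.1 hA)))⟩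
      · refine absurd (top_le_iff.1 fun a _ => ?_) hne
        have h2 : f a ∈ q.ker.map f := hB ▸ Subgroup.mem_top _
        obtain ⟨b, hb, hab⟩ := h2
        have h3 : b⁻¹ * a ∈ f.ker := by
          rw [MonoidHom.mem_ker, map_mul, map_inv, hab, inv_mul_cancel]
        simpa using mul_mem hb (hle h3)
  · refine Or.inl (isCyclic_of_isSimpleGroup_of_commute fun x y => ?_)
    obtain ⟨a, ha, rfl⟩ : x ∈ f.ker.map q := h ▸ Subgroup.mem_top x
    obtain ⟨b, hb, rfl⟩ : y ∈ f.ker.map q := h ▸ Subgroup.mem_top y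
    rw [← map_mul, ← map_mul, hcomm a ha b hb]

variable {G : Type u} [Group G]

/-- Descending from the top: while a term maps onto `T`, the image of the next lower one is normal
in the simple group `T`. -/
theorem GroupCompositionSeries.map_eq_bot_or_eq_top (c : GroupCompositionSeries G) {T : Type v}
    [Group T] [IsSimpleGroup T] (f : G →* T) (hf : Function.Surjective f)
    (i : Fin (c.length + 1)) : (c.term i).map f = ⊥ ∨ (c.term i).map f = ⊤ := by
  induction i using Fin.reverseInduction with
  | last =>
    right
    rw [c.term_last, ← MonoidHom.range_eq_map, MonoidHom.range_eq_top.2 hf]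
  | cast i ih =>
    rcases ih with h | h
    · exact Or.inl (le_bot_iff.1 (h ▸ Subgroup.map_mono (c.le_succ i)))
    · refine Subgroup.Normal.eq_bot_or_eq_top ⟨?_⟩
      rintro _ ⟨a, ha, rfl⟩ y
      obtain ⟨b, hb, rfl⟩ : y ∈ (c.term i.succ).map f := h ▸ Subgroup.mem_top y
      refine ⟨b * a * b⁻¹, ?_, by simp⟩
      exact (c.normal i).conj_mem ⟨a, c.le_succ i ha⟩ (Subgroup.mem_subgroupOf.2 ha) ⟨b, hb⟩

theorem isSolvableRel_of_surjective {T : Type v} [Group T] [IsSimpleGroup T] (f : G →* T)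
    (hf : Function.Surjective f) (hcomm : ∀ a ∈ f.ker, ∀ b ∈ f.ker, a * b = b * a) :
    IsSolvableRel T G := by
  intro c i
  have := c.normal i
  have := c.simple i
  refine isCyclic_or_nonempty_mulEquiv_of_surjective (QuotientGroup.mk' _)
    (QuotientGroup.mk'_surjective _) (f.comp (c.term i.succ).subtype) ?_ ?_ ?_
  · intro a ha b hb
    exact Subtype.ext (hcomm a ha b hb)
  · rw [MonoidHom.range_comp, Subgroup.range_subtype]
    exact c.map_eq_bot_or_eq_top f hf _
  · rw [QuotientGroup.ker_mk', ← Subgroup.map_map, Subgroup.subgroupOf_map_subtype,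
      inf_eq_left.2 (c.le_succ i)]
    exact c.map_eq_bot_or_eq_top f hf _

/-- `K` is normal in `H`, with simple quotient. -/
structure IsSimpleStep (K H : Subgroup G) : Prop where
  le : K ≤ H
  normal : (K.subgroupOf H).Normal
  simple : IsSimpleGroup (H ⧸ K.subgroupOf H)

theorem IsSimpleStep.of_covBy {K H : Subgroup G} (h : K ⋖ H)
    (hcomm : ∀ a ∈ H, ∀ b ∈ H, a * b = b * a) : IsSimpleStep K H := by
  have hn : (K.subgroupOf H).Normal := ⟨fun a ha b => by
    have h1 : b * a = a * b := Subtype.ext (hcomm b b.2 a a.2)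
    rwa [h1, mul_inv_cancel_right]⟩
  refine ⟨h.le, hn, ?_⟩
  have hnt : Nontrivial (H ⧸ K.subgroupOf H) := by
    rw [QuotientGroup.nontrivial_iff]
    intro h1
    exact h.lt.not_ge (Subgroup.subgroupOf_eq_top.1 h1)
  refine { eq_bot_or_eq_top_of_normal := fun J _ => ?_ }
  -- The preimage of `J` lies between `K` and `H`, so it is one of them.
  have h1 : K ≤ (J.comap (QuotientGroup.mk' (K.subgroupOf H))).map H.subtype := fun x hx =>
    ⟨⟨x, h.le hx⟩, by
      have h2 : QuotientGroup.mk' (K.subgroupOf H) ⟨x, h.le hx⟩ = 1 :=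
        (QuotientGroup.eq_one_iff _).2 (Subgroup.mem_subgroupOf.2 hx)
      change QuotientGroup.mk' (K.subgroupOf H) ⟨x, h.le hx⟩ ∈ J
      rw [h2]
      exact one_mem J, rfl⟩
  have hJ : ∀ a : H, (a : G) ∈ (J.comap (QuotientGroup.mk' (K.subgroupOf H))).map H.subtype ↔
      (a : H ⧸ K.subgroupOf H) ∈ J := fun a =>
    ⟨fun ⟨b, hb, hab⟩ => (Subtype.ext hab : b = a) ▸ hb, fun ha => ⟨a, ha, rfl⟩⟩
  rcases h.eq_or_eq h1 (Subgroup.map_subtype_le _) with h2 | h2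
  · left
    refine (Subgroup.eq_bot_iff_forall _).2 fun x hx => ?_
    obtain ⟨a, rfl⟩ := QuotientGroup.mk_surjective x
    rw [← hJ, h2] at hx
    exact (QuotientGroup.eq_one_iff a).2 (Subgroup.mem_subgroupOf.2 hx)
  · right
    refine (Subgroup.eq_top_iff' _).2 fun x => ?_
    obtain ⟨a, rfl⟩ := QuotientGroup.mk_surjective x
    rw [← hJ, h2]
    exact a.2

theorem exists_simpleStep_chain [Finite G] (H : Subgroup G)
    (hcomm : ∀ a ∈ H, ∀ b ∈ H, a * b = b * a) :
    ∃ (n : ℕ) (s : ℕ → Subgroup G), s 0 = ⊥ ∧ s n = H ∧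
      ∀ i < n, IsSimpleStep (s i) (s (i + 1)) := by
  induction H using WellFoundedLT.induction with
  | ind H ih =>
    rcases eq_bot_or_bot_lt H with rfl | hH
    · exact ⟨0, fun _ => ⊥, rfl, rfl, by simp⟩
    · obtain ⟨K, -, hK⟩ := exists_le_covBy_of_lt hH
      obtain ⟨n, s, h0, hn, hs⟩ := ih K hK.lt fun a ha b hb => hcomm a (hK.le ha) b (hK.le hb)
      -- The chain for a maximal subgroup `K` of `H`, with `H` appended.
      refine ⟨n + 1, fun i => if i ≤ n then s i else H, by simpa using h0, by simp, fun i hi => ?_⟩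
      rcases Nat.lt_succ_iff_lt_or_eq.1 hi with h | rfl
      · simpa [h.le, Nat.succ_le_of_lt h] using hs i h
      · simpa [hn] using IsSimpleStep.of_covBy hK hcomm

theorem exists_compositionSeries_of_chain {n : ℕ} {s : ℕ → Subgroup G} (h0 : s 0 = ⊥)
    (hn : s n = ⊤) (hs : ∀ i < n, IsSimpleStep (s i) (s (i + 1))) {i : ℕ} (hi : i < n) :
    ∃ (c : GroupCompositionSeries G) (j : Fin c.length),
      c.term j.castSucc = s i ∧ c.term j.succ = s (i + 1) :=
  ⟨{  length := n
      term := fun i => s i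
      term_zero := h0
      term_last := hn
      le_succ := fun i => (hs i i.2).le
      normal := fun i => (hs i i.2).normal
      simple := fun i => (hs i i.2).simple }, ⟨i, hi⟩, rfl, rfl⟩

theorem nonempty_quotient_ker_subgroupOf_top_mulEquiv {T : Type v} [Group T] (f : G →* T)
    (hf : Function.Surjective f) : Nonempty ((⊤ : Subgroup G) ⧸ f.ker.subgroupOf ⊤ ≃* T) := by
  have hker : f.ker.subgroupOf ⊤ = (f.comp (⊤ : Subgroup G).subtype).ker := rfl
  have hsurj : Function.Surjective (f.comp (⊤ : Subgroup G).subtype) := fun x => by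
    obtain ⟨g, rfl⟩ := hf x
    exact ⟨⟨g, Subgroup.mem_top g⟩, rfl⟩
  exact ⟨(QuotientGroup.quotientMulEquivOfEq hker).trans
    (QuotientGroup.quotientKerEquivOfSurjective _ hsurj)⟩

/-- Keeping `K`, `H` and the normality proof variable lets the equalities be substituted although
the quotient's group structure depends on them. -/
theorem nonempty_quotient_mulEquiv_of_eq {T : Type v} [Group T] (f : G →* T)
    (hf : Function.Surjective f) {K H : Subgroup G} (hN : (K.subgroupOf H).Normal)
    (hK : K = f.ker) (hH : H = ⊤) : Nonempty (H ⧸ K.subgroupOf H ≃* T) := by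
  subst hK hH
  exact nonempty_quotient_ker_subgroupOf_top_mulEquiv f hf

theorem isCompositionFactor_of_surjective [Finite G] {T : Type v} [Group T] [IsSimpleGroup T]
    (f : G →* T) (hf : Function.Surjective f)
    (hcomm : ∀ a ∈ f.ker, ∀ b ∈ f.ker, a * b = b * a) : IsCompositionFactor T G := by
  obtain ⟨n, s, h0, hn, hs⟩ := exists_simpleStep_chain f.ker hcomm
  have hnorm : (f.ker.subgroupOf ⊤).Normal := inferInstance
  obtain ⟨e⟩ := nonempty_quotient_ker_subgroupOf_top_mulEquiv f hf
  have hstep : ∀ i < n + 1, IsSimpleStep (if i ≤ n then s i else ⊤)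
      (if i + 1 ≤ n then s (i + 1) else ⊤) := fun i hi => by
    rcases Nat.lt_succ_iff_lt_or_eq.1 hi with h | rfl
    · simpa [h.le, Nat.succ_le_of_lt h] using hs i h
    · simp only [le_refl, if_true, hn, Nat.not_succ_le_self, if_false]
      exact ⟨le_top, hnorm, e.isSimpleGroup⟩
  obtain ⟨c, i, hK, hH⟩ := exists_compositionSeries_of_chain
    (s := fun i => if i ≤ n then s i else ⊤) (by simpa using h0) (by simp) hstep n.lt_succ_self
  rw [if_pos le_rfl, hn] at hK
  rw [if_neg n.not_succ_le_self] at hH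
  exact ⟨c, i, nonempty_quotient_mulEquiv_of_eq f hf (c.normal i) hK hH⟩

end CompositionFactors

/-! ### Finite invariant subgroups of modular representations -/

section InvariantSubgroup

variable {p : ℕ} [Fact p.Prime] {T : Type u} [Group T] {V : Type w} [AddCommGroup V]
  [Module (ZMod p) V]

/-- The action of `T` on an invariant subgroup, written multiplicatively. -/
def invariantSubmoduleAction (σ : T →* Module.End (ZMod p) V) (W : Submodule (ZMod p) V)
    (hW : ∀ t, ∀ w ∈ W, σ t w ∈ W) : T →* MulAut (Multiplicative W) where
  toFun t := AddEquiv.toMultiplicative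
    { toFun := fun w => ⟨σ t w, hW t w w.2⟩
      invFun := fun w => ⟨σ t⁻¹ w, hW t⁻¹ w w.2⟩
      left_inv := fun w => Subtype.ext (by
        change σ t⁻¹ (σ t w) = w
        rw [← Module.End.mul_apply, ← map_mul, inv_mul_cancel, map_one, Module.End.one_apply])
      right_inv := fun w => Subtype.ext (by
        change σ t (σ t⁻¹ w) = w
        rw [← Module.End.mul_apply, ← map_mul, mul_inv_cancel, map_one, Module.End.one_apply])
      map_add' := fun a b => Subtype.ext (map_add (σ t) a.1 b.1) }
  map_one' := by
    ext w
    change σ 1 (w.toAdd : V) = (w.toAdd : V)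
    rw [map_one, Module.End.one_apply]
  map_mul' a b := by
    ext w
    change σ (a * b) (w.toAdd : V) = σ a (σ b (w.toAdd : V))
    rw [map_mul, Module.End.mul_apply]

/-- The orbits of finitely many vectors under a finite group span a finite-dimensional, hence
finite, space over `𝔽_p`. -/
theorem exists_finite_invariant_submodule [Finite T] (σ : T →* Module.End (ZMod p) V) (v : T → V) :
    ∃ W : Submodule (ZMod p) V, Finite W ∧ (∀ t, ∀ w ∈ W, σ t w ∈ W) ∧ ∀ t, v t ∈ W := by
  refine ⟨Submodule.span (ZMod p) (Set.range fun x : T × T => σ x.1 (v x.2)), ?_, ?_, ?_⟩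
  · have := FiniteDimensional.span_of_finite (ZMod p)
      (Set.finite_range fun x : T × T => σ x.1 (v x.2))
    exact Module.finite_of_finite (ZMod p)
  · intro t w hw
    induction hw using Submodule.span_induction with
    | mem x hx =>
      obtain ⟨⟨a, b⟩, rfl⟩ := hx
      refine Submodule.subset_span ⟨(t * a, b), ?_⟩
      simp only [map_mul, Module.End.mul_apply]
    | zero => rw [map_zero]; exact Submodule.zero_mem _
    | add x y _ _ hx hy => rw [map_add]; exact Submodule.add_mem _ hx hy
    | smul c x _ hx => rw [map_smul]; exact Submodule.smul_mem _ c hx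
  · intro t
    exact Submodule.subset_span ⟨(1, t), by simp⟩

/-- A finite elementary abelian `p`-group with an action of `T` in which the elements with
nontrivial fixed points are those having a nonzero fixed vector in `V`. -/
theorem exists_finite_module_with_same_fixed_points [Finite T] (σ : T →* Module.End (ZMod p) V) :
    ∃ (N : Type w) (_ : CommGroup N) (φ : T →* MulAut N), Finite N ∧ (∀ n : N, n ^ p = 1) ∧
      ∀ t, (∃ n : N, n ≠ 1 ∧ φ t n = n) ↔ ∃ v : V, v ≠ 0 ∧ σ t v = v := by
  classical
  -- One fixed vector is chosen per `t`, with 0 as a dummy value if there is none.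
  have hv : ∀ t, ∃ v : V, (∃ v : V, v ≠ 0 ∧ σ t v = v) → v ≠ 0 ∧ σ t v = v := fun t => by
    by_cases h : ∃ v : V, v ≠ 0 ∧ σ t v = v
    · exact ⟨h.choose, fun _ => h.choose_spec⟩
    · exact ⟨0, fun h1 => absurd h1 h⟩
  choose v hv using hv
  obtain ⟨W, hfin, hW, hvW⟩ := exists_finite_invariant_submodule σ v
  refine ⟨Multiplicative W, inferInstance, invariantSubmoduleAction σ W hW, inferInstance,
    fun n => ?_, fun t => ⟨?_, fun h => ?_⟩⟩
  · refine Multiplicative.toAdd.injective ?_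
    rw [toAdd_pow, toAdd_one, ← Nat.cast_smul_eq_nsmul (ZMod p), CharP.cast_eq_zero, zero_smul]
  · rintro ⟨n, hn, h⟩
    refine ⟨(n.toAdd : V), fun h0 => hn ?_, ?_⟩
    · exact Multiplicative.toAdd.injective (Subtype.ext h0)
    · exact congrArg (fun m : Multiplicative W => (m.toAdd : V)) h
  · refine ⟨Multiplicative.ofAdd ⟨v t, hvW t⟩, fun h0 => (hv t h).1 ?_, ?_⟩
    · exact congrArg (fun m : Multiplicative W => (m.toAdd : V)) h0
    · exact Multiplicative.toAdd.injective (Subtype.ext (hv t h).2)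

end InvariantSubgroup

/-! ### Prime graphs of semidirect products -/

section PrimeGraph

variable {N : Type v} [CommGroup N] {T : Type u} [Group T]
  {φ : T →* MulAut N} {p : ℕ}

theorem primeDivisors_semidirectProduct [Finite N] (hp : p ∈ primeDivisors T) (hN : ∀ n : N, n ^ p = 1) :
    primeDivisors (N ⋊[φ] T) = primeDivisors T := by
  ext r
  simp only [primeDivisors, Set.mem_ofPred_eq, SemidirectProduct.card]
  refine and_congr_right fun hr => ⟨fun h => ?_, fun h => h.mul_left _⟩
  rcases (Nat.Prime.dvd_mul hr).1 h with h | h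
  · have := Fact.mk hr
    obtain ⟨n, hn⟩ := exists_prime_orderOf_dvd_card' r h
    have h1 : r ∣ p := hn ▸ orderOf_dvd_of_pow_eq_one (hN n)
    exact (Nat.prime_dvd_prime_iff_eq hr hp.1).1 h1 ▸ hp.2
  · exact h

theorem exists_orderOf_eq_prime_mul_prime_iff (hp : p.Prime) (hN : ∀ n : N, n ^ p = 1)
    {r s : ℕ} (hr : r.Prime) (hs : s.Prime) (hrs : r ≠ s) {R : Set ℕ}
    (hR : ∀ x : ℕ, x.Prime → x ≠ p →
      ((∃ t : T, orderOf t = x ∧ ∃ n : N, n ≠ 1 ∧ φ t n = n) ↔ x ∈ R)) :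
    (∃ g : N ⋊[φ] T, orderOf g = r * s) ↔
      (∃ t : T, orderOf t = r * s) ∨ ∃ x ∈ R, s(r, s) = s(p, x) := by
  by_cases h1 : r = p
  · subst h1
    rw [SemidirectProduct.exists_orderOf_eq_mul_iff hp hN hs hrs, hR s hs hrs.symm]
    simp [hrs.symm]
  by_cases h2 : s = p
  · subst h2
    rw [mul_comm r, SemidirectProduct.exists_orderOf_eq_mul_iff hp hN hr hrs.symm, hR r hr hrs,
      Sym2.eq_swap]
    simp [hrs]
  · rw [SemidirectProduct.exists_orderOf_eq_iff_of_coprime hN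
      (Nat.Coprime.mul_left ((Nat.coprime_primes hr hp).2 h1) ((Nat.coprime_primes hs hp).2 h2))]
    refine ⟨Or.inl, Or.rec id ?_⟩
    rintro ⟨x, -, hx⟩
    rcases Sym2.eq_iff.1 hx with h | h
    · exact absurd h.1 h1
    · exact absurd h.2 h2

theorem primeGraphCompl_semidirectProduct [Finite N] (hp : p ∈ primeDivisors T)
    (hN : ∀ n : N, n ^ p = 1) {R : Set ℕ}
    (hR : ∀ x : ℕ, x.Prime → x ≠ p →
      ((∃ t : T, orderOf t = x ∧ ∃ n : N, n ≠ 1 ∧ φ t n = n) ↔ x ∈ R)) :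
    primeGraphCompl (N ⋊[φ] T) = (primeGraphCompl T).deleteEdges {e | ∃ r ∈ R, e = s(p, r)} := by
  have hverts := primeDivisors_semidirectProduct (φ := φ) hp hN
  refine SimpleGraph.Subgraph.ext hverts ?_
  ext r s
  rw [SimpleGraph.Subgraph.deleteEdges_adj]
  simp only [primeGraphCompl, LabelledGraph.complement, primeGraph, hverts, Set.mem_ofPred_eq]
  by_cases hrs : r ≠ s ∧ r ∈ primeDivisors T ∧ s ∈ primeDivisors T
  · obtain ⟨hrs, hr, hs⟩ := hrs
    rw [exists_orderOf_eq_prime_mul_prime_iff hp.1 hN hr.1 hs.1 hrs hR]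
    simp only [hr, hs, hrs, ne_eq, not_false_eq_true, true_and, not_or]
  · tauto

end PrimeGraph

theorem mem_positiveAveragePrimes_brauerCharacter_iff {p : ℕ} [Fact p.Prime]
    {lift : AlgebraicClosure (ZMod p) →*₀ ℂ} (hlift : Function.Injective lift)
    {T : Type u} [Group T] [Finite T] {V : Type w} [AddCommGroup V]
    [Module (AlgebraicClosure (ZMod p)) V] [FiniteDimensional (AlgebraicClosure (ZMod p)) V]
    (ρ : Representation (AlgebraicClosure (ZMod p)) T V) {x : ℕ} (hx : x.Prime) (hxp : x ≠ p) :
    x ∈ positiveAveragePrimes (brauerCharacter lift ρ) ↔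
      ∃ t : T, orderOf t = x ∧ ∃ v : V, v ≠ 0 ∧ ρ t v = v := by
  simp only [positiveAveragePrimes, Set.mem_ofPred_eq,
    brauerCharacter_average_pos_iff lift ρ hlift]
  constructor
  · rintro ⟨-, t, ht⟩
    exact ⟨t.1, ht⟩
  · rintro ⟨t, ht, h⟩
    refine ⟨hx, ⟨t, fun hpt => hxp ?_⟩, ht, h⟩
    rw [ht] at hpt
    exact ((Nat.prime_dvd_prime_iff_eq Fact.out hx).1 hpt).symm

theorem mainTheorem7 {T : Type u} [Group T] [Finite T] [IsSimpleGroup T]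
    (p : ℕ) [Fact p.Prime] (hp : p ∈ primeDivisors T)
    (lift : AlgebraicClosure (ZMod p) →*₀ ℂ) (hlift : Function.Injective lift)
    (χ : PRegular p T → ℂ) (hχ : IsIrreducibleBrauerCharacter lift χ) :
    ∃ (G : Type u) (_ : Group G), Finite G ∧ IsStrictlySolvableRel T G ∧
      primeGraphCompl G =
        (primeGraphCompl T).deleteEdges {e | ∃ r ∈ positiveAveragePrimes χ, e = s(p, r)} := by
  obtain ⟨n, ρ, -, rfl⟩ := hχ
  -- Over `𝔽_p` finitely generated submodules are finite, and the fixed vectors are the same.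
  let σ : T →* Module.End (ZMod p) (Fin n → AlgebraicClosure (ZMod p)) :=
    { toFun := fun t => (ρ t).restrictScalars (ZMod p)
      map_one' := by rw [map_one]; rfl
      map_mul' := fun a b => by rw [map_mul]; rfl }
  obtain ⟨N, _, φ, hfin, hN, hfix⟩ := exists_finite_module_with_same_fixed_points σ
  have hfinG : Finite (N ⋊[φ] T) := Finite.of_equiv _ SemidirectProduct.equivProd.symm
  have hcomm : ∀ a ∈ (SemidirectProduct.rightHom : N ⋊[φ] T →* T).ker,
      ∀ b ∈ (SemidirectProduct.rightHom : N ⋊[φ] T →* T).ker, a * b = b * a := by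
    rw [← SemidirectProduct.range_inl_eq_ker_rightHom]
    rintro _ ⟨a, rfl⟩ _ ⟨b, rfl⟩
    rw [← map_mul, mul_comm, map_mul]
  refine ⟨N ⋊[φ] T, inferInstance, hfinG,
    ⟨isSolvableRel_of_surjective _ SemidirectProduct.rightHom_surjective hcomm,
      isCompositionFactor_of_surjective _ SemidirectProduct.rightHom_surjective hcomm⟩,
    primeGraphCompl_semidirectProduct hp hN fun x hx hxp => ?_⟩
  rw [mem_positiveAveragePrimes_brauerCharacter_iff hlift ρ hx hxp]
  exact exists_congr fun t => and_congr_right fun _ => hfix t
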